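/- Let $M$ be a smooth finite-dimensional manifold (Hausdorff, second countable, nonempty) with a smooth torsion-free affine connection $\nabla$ such that for every $x\in M$ the exponential map $\exp_x$ is defined on all of $T_xM$ and maps onto $M$. A set $C\subseteq M$ is convex if it contains every geodesic segment whose end points lie in $C$; a function is convex on $C$ if it is convex along every geodesic segment in $C$. For a smooth $f$ let $Hf(X,Y)=X(Df(Y))-Df(\nabla_XY)$ be its Hessian and $(\nabla_Z Hf)(X,Y)=Z(Hf(X,Y))-Hf(\nabla_ZX,Y)-Hf(X,\nabla_ZY)$. For $\sigma\ge 0$ and an open convex set $C\subseteq M$, a smooth convex function $f:C\to\mathbb R$ is called $\sigma$-self-concordant ($\sigma$-SC) if its epigraph $\{(x,y)\in C\times\mathbb R: f(x)\le y\}$ is closed in $M\times\mathbb R$, $Hf_x$ is positive definite for all $x\in C$, and $$|(\nabla_vHf)(u,u)|\le 2\sigma\,Hf(v,v)^{1/2}\,Hf(u,u)\qquad(x\in C,\ u,v\in T_xM).$$ For $\nu>0$, a $\nu$-self-concordant barrier of a set $Q\subseteq M$ that is the closure of its interior $Q^\circ$ is a $1$-SC function $F:Q^\circ\to\mathbb R$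 with $2DF_x(u)-HF_x(u,u)\le\nu$ for all $x\in Q^\circ$ and $u\in T_xM$. Let $\sigma \ge 0$, let $f:M\to\mathbb R$ be $\sigma$-SC with $f^*:=\inf_M f>-\infty$, let $\beta>f^*$, let $L_{f,\beta}=\{x\in M: f(x)\le\beta\}$, and let $L_{f,\beta}^\circ$ be its interior. Then $F_\beta:=-\log(\beta-f):L_{f,\beta}^\circ\to\mathbb R$ is $\tilde\sigma$-SC for $$\tilde\sigma:=\sqrt{\bigl(\sigma(\beta-f^*)^{1/2}+1\bigr)^2+\tfrac94}.$$ Moreover, there is a universal constant $K>0$ (independent of $M,\nabla,f,\sigma,\beta$) such that $L_{f,\beta}$ admits a $\nu$-self-concordant barrier with $$\nu\le K\max\{1,\ \sigma^2(\beta-f^*)\};$$ in particular $\nu \le K\sigma^2(\beta-f^*)$ whenever $\sigma^2(\beta-f^*)\ge 1$. -/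

import Mathlib

open scoped Manifold ContDiff

/-! Self-concordant functions on a smooth manifold with an affine connection. -/

noncomputable section

namespace SelfConcordance

variable {E : Type*} [NormedAddCommGroup E] [NormedSpace ℝ E]
  {M : Type*} [TopologicalSpace M] [ChartedSpace E M] [IsManifold 𝓘(ℝ, E) ∞ M]

/-- An affine connection on `M`: a covariant derivative on the tangent bundle. In Mathlib's
convention `cov Y x u` is `∇_u Y` for a vector field `Y` and a tangent vector `u` at `x`. -/
abbrev AffineConnection (E : Type*) [NormedAddCommGroup E] [NormedSpace ℝ E]
    (M : Type*) [TopologicalSpace M] [ChartedSpace E M] [IsManifold 𝓘(ℝ, E) ∞ M] :=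
  CovariantDerivative 𝓘(ℝ, E) E (TangentSpace 𝓘(ℝ, E) : M → Type _)

/-- The vector field extending the tangent vector `u` at `x`: the local field with constant
coefficients in the trivialization of the tangent bundle at `x`. It is smooth near `x`. -/
def extendVec {x : M} (u : TangentSpace 𝓘(ℝ, E) x) : (y : M) → TangentSpace 𝓘(ℝ, E) y :=
  FiberBundle.extend E u

/-- The covariant derivative of a `(0,1)`-tensor field:
`(∇_u α)(v) = u (α(Y)) - α(∇_u Y)`, where `Y` is a vector field extending `v`. -/
def covDerivOneForm (cov : AffineConnection E M)
    (α : (y : M) → TangentSpace 𝓘(ℝ, E) y → ℝ) (x : M) (u v : TangentSpace 𝓘(ℝ, E) x) : ℝ :=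
  mvfderiv 𝓘(ℝ, E) (fun y => α y (extendVec v y)) x u - α x (cov (extendVec v) x u)

/-- The covariant derivative of a `(0,2)`-tensor field:
`(∇_u G)(v, w) = u (G(Y, Z)) - G(∇_u Y, w) - G(v, ∇_u Z)`,
where `Y`, `Z` are vector fields extending `v`, `w`. -/
def covDerivBilin (cov : AffineConnection E M)
    (G : (y : M) → TangentSpace 𝓘(ℝ, E) y → TangentSpace 𝓘(ℝ, E) y → ℝ)
    (x : M) (u v w : TangentSpace 𝓘(ℝ, E) x) : ℝ :=
  mvfderiv 𝓘(ℝ, E) (fun y => G y (extendVec v y) (extendVec w y)) x u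
    - G x (cov (extendVec v) x u) w - G x v (cov (extendVec w) x u)

/-- The differential `Df_x(u)` of a function. -/
def differential (f : M → ℝ) (x : M) (u : TangentSpace 𝓘(ℝ, E) x) : ℝ :=
  mvfderiv 𝓘(ℝ, E) f x u

/-- The Hessian `Hf_x(u, v) = (∇_u Df)(v)`. -/
def hessian (cov : AffineConnection E M) (f : M → ℝ) (x : M)
    (u v : TangentSpace 𝓘(ℝ, E) x) : ℝ :=
  covDerivOneForm cov (differential f) x u v

/-- The velocity `γ'(t)` of a curve. -/
def velocity (γ : ℝ → M) (t : ℝ) : TangentSpace 𝓘(ℝ, E) (γ t) :=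
  mfderiv 𝓘(ℝ, ℝ) 𝓘(ℝ, E) γ t (1 : ℝ)

/-- The covariant derivative along a curve `γ` of a vector field `V` along `γ`. If `e i` is the
frame given by the trivialization of the tangent bundle at `γ t` and `V s = ∑ i, c i s • e i (γ s)`
for `s` near `t`, this is `∑ i, (c i)' t • e i (γ t) + ∑ i, c i t • ∇_{γ' t} (e i)`; the second sum
is the derivative in direction `γ' t` of the field that extends `V t` with constant coefficients. -/
def covDerivAlong (cov : AffineConnection E M) (γ : ℝ → M)
    (V : (t : ℝ) → TangentSpace 𝓘(ℝ, E) (γ t)) (t : ℝ) : TangentSpace 𝓘(ℝ, E) (γ t) :=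
  let e := trivializationAt E (TangentSpace 𝓘(ℝ, E) : M → Type _) (γ t)
  e.symm (γ t) (deriv (fun s => (e ⟨γ s, V s⟩).2) t)
    + cov (extendVec (V t)) (γ t) (velocity γ t)

/-- Geodesics, parametrized by the whole line: smooth curves with `∇_{γ'} γ' = 0`. All connections
considered here are complete, so that every geodesic `[a, b] → M` is the restriction of one. -/
def IsGeodesic (cov : AffineConnection E M) (γ : ℝ → M) : Prop :=
  ContMDiff 𝓘(ℝ, ℝ) 𝓘(ℝ, E) ∞ γ ∧ ∀ t, covDerivAlong cov γ (velocity γ) t = 0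

/-- Every exponential map `exp_x` is defined on the whole tangent space `T_x`. -/
def IsGeodesicallyComplete (cov : AffineConnection E M) : Prop :=
  ∀ (x : M) (u : TangentSpace 𝓘(ℝ, E) x), ∃ γ : ℝ → M, IsGeodesic cov γ ∧
    (⟨γ 0, velocity γ 0⟩ : TangentBundle 𝓘(ℝ, E) M) = ⟨x, u⟩

/-- Every exponential map `exp_x : T_x → M` is surjective. -/
def ExpSurjective (cov : AffineConnection E M) : Prop :=
  ∀ x y : M, ∃ γ : ℝ → M, IsGeodesic cov γ ∧ γ 0 = x ∧ γ 1 = y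

/-- Geodesic convexity of a set. -/
def GeodConvex (cov : AffineConnection E M) (C : Set M) : Prop :=
  ∀ γ : ℝ → M, IsGeodesic cov γ → ∀ a b : ℝ, a ≤ b → γ a ∈ C → γ b ∈ C →
    ∀ t ∈ Set.Icc a b, γ t ∈ C

/-- Geodesic convexity of a function on `C`. -/
def GeodConvexOn (cov : AffineConnection E M) (C : Set M) (f : M → ℝ) : Prop :=
  ∀ γ : ℝ → M, IsGeodesic cov γ → ∀ a b : ℝ, a ≤ b → (∀ t ∈ Set.Icc a b, γ t ∈ C) →
    ConvexOn ℝ (Set.Icc a b) (fun t => f (γ t))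

/-- `f` is a `σ`-self-concordant function on the open convex set `C`; only the values of `f` on `C`
matter. -/
structure IsSelfConcordant (cov : AffineConnection E M) (σ : ℝ) (C : Set M) (f : M → ℝ) :
    Prop where
  sigma_nonneg : 0 ≤ σ
  isOpen_domain : IsOpen C
  convex_domain : GeodConvex cov C
  smooth : ContMDiffOn 𝓘(ℝ, E) 𝓘(ℝ, ℝ) ∞ f C
  convex : GeodConvexOn cov C f
  closed : IsClosed {p : M × ℝ | p.1 ∈ C ∧ f p.1 ≤ p.2}
  nondegenerate : ∀ x ∈ C, ∀ u : TangentSpace 𝓘(ℝ, E) x, u ≠ 0 → 0 < hessian cov f x u u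
  concordant : ∀ x ∈ C, ∀ u v : TangentSpace 𝓘(ℝ, E) x,
    |covDerivBilin cov (hessian cov f) x v u u|
      ≤ 2 * σ * √(hessian cov f x v v) * hessian cov f x u u

/-- `F` is a `ν`-self-concordant barrier on the open convex set `C`. -/
structure IsSelfConcordantBarrier (cov : AffineConnection E M) (ν : ℝ) (C : Set M) (F : M → ℝ) :
    Prop where
  nu_pos : 0 < ν
  selfConcordant : IsSelfConcordant cov 1 C F
  barrier : ∀ x ∈ C, ∀ u : TangentSpace 𝓘(ℝ, E) x,
    2 * differential F x u - hessian cov F x u u ≤ ν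

/-- The set `Q` admits a `ν`-self-concordant barrier: `Q` is the closure of its interior, and there
is a `ν`-self-concordant barrier on the interior. -/
def AdmitsBarrier (cov : AffineConnection E M) (ν : ℝ) (Q : Set M) : Prop :=
  closure (interior Q) = Q ∧ ∃ F : M → ℝ, IsSelfConcordantBarrier cov ν (interior Q) F

/-- The sublevel set `L_{f, β}`. -/
def sublevel (f : M → ℝ) (β : ℝ) : Set M := {x | f x ≤ β}

/-- The logarithmic barrier `F_β = -log (β - f)`, considered on the interior of `L_{f, β}`. -/
def logBarrier (f : M → ℝ) (β : ℝ) (x : M) : ℝ := -Real.log (β - f x)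

end SelfConcordance

end

/-! At a point `x` with `f x < β` put `w = β - f x`, `m = β - f*` and `F = -log (β - f)`. The chain
rule gives `DF = w⁻¹ Df` and `HF = w⁻¹ Hf + w⁻² Df ⊗ Df`. Hence `HF(u,u) = r² + t²` with `r² =
Hf(u,u)/w`, `t = |Df(u)|/w`, and likewise `HF(v,v) = p² + q²` for `v`. Each term of `(∇_v HF)(u,u)`
is then bounded in these four quantities. Self-concordance of `f` handles `∇Hf`, with `w ≤ m`
turning `σ` into `σ√m`. The mixed terms need Cauchy-Schwarz for `Hf`, hence its symmetry, which is
where vanishing torsion enters. What remains is `concordance_inequality`. For the barrier, `HF(u,u)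
≥ DF(u)²` gives `2DF(u) - HF(u,u) ≤ 1`. Multiplying `F` by `σ̃²` makes it 1-self-concordant and
raises the parameter from 1 to `σ̃²`, which is `O(max 1 (σ² m))`. Convexity along geodesics,
together with surjectivity of `exp`, identifies the interior of the sublevel set with `{f < β}`. -/

open Filter Topology VectorField FiberBundle

noncomputable section

namespace SelfConcordance

/-! ### Differentials along vector fields, and global extensions of tangent vectors -/

section

variable {E : Type*} [NormedAddCommGroup E] [NormedSpace ℝ E]
  {M : Type*} [TopologicalSpace M] [ChartedSpace E M]

/-- Chain rule for the differential of a scalar function of a scalar function. -/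
lemma mvfderiv_scalar_comp {f : M → ℝ} {x : M} {φ : ℝ → ℝ} {c : ℝ}
    (hφ : HasDerivAt φ c (f x)) (hf : MDiffAt f x) (u : TangentSpace 𝓘(ℝ, E) x) :
    mvfderiv 𝓘(ℝ, E) (fun y => φ (f y)) x u = c * mvfderiv 𝓘(ℝ, E) f x u := by
  have h := mvfderiv_comp_apply (I' := 𝓘(ℝ, E)) (I := 𝓘(ℝ, ℝ)) (g := φ) (f := f) x
    hφ.differentiableAt.mdifferentiableAt hf u
  have h2 : mvfderiv 𝓘(ℝ, ℝ) φ (f x) = ContinuousLinearMap.toSpanSingleton ℝ c := by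
    simpa [mvfderiv] using! hφ.hasFDerivAt.fderiv
  rw [h2] at h
  exact h.trans (mul_comm _ _)

lemma mvfderiv_congr {f g : M → ℝ} {x : M} (h : f =ᶠ[𝓝 x] g) (u : TangentSpace 𝓘(ℝ, E) x) :
    mvfderiv 𝓘(ℝ, E) f x u = mvfderiv 𝓘(ℝ, E) g x u := by
  have h1 := h.mfderiv_eq (I := 𝓘(ℝ, E)) (I' := 𝓘(ℝ, ℝ))
  simp only [mvfderiv, ContinuousLinearMap.comp_apply, h1]
  rfl

variable [IsManifold 𝓘(ℝ, E) ∞ M]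

/-- The differential of a smooth function along a smooth vector field is smooth. -/
lemma contMDiffAt_mvfderiv_apply {f : M → ℝ} {x : M} {m n : ℕ∞} (hmn : m + 1 ≤ n)
    {Y : (y : M) → TangentSpace 𝓘(ℝ, E) y}
    (hf : CMDiffAt n f x) (hY : CMDiffAt m (T% Y) x) :
    CMDiffAt m (fun y => mvfderiv 𝓘(ℝ, E) f y (Y y)) x := by
  have h1 := hf.mfderiv_const (m := m) (by exact_mod_cast hmn)
  have h2 := ContMDiffAt.clm_apply_of_inCoordinates h1 hY (hf.of_le (by exact_mod_cast le_self_add.trans hmn))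
  simpa using! (Bundle.contMDiffAt_totalSpace.1 h2).2

lemma mdifferentiableAt_mvfderiv_apply {f : M → ℝ} {x : M}
    {Y : (y : M) → TangentSpace 𝓘(ℝ, E) y}
    (hf : CMDiffAt 2 f x) (hY : MDiffAt (T% Y) x) :
    MDiffAt (fun y => mvfderiv 𝓘(ℝ, E) f y (Y y)) x := by
  have h1 := (hf.mfderiv_const (m := 1) (by norm_num)).mdifferentiableAt one_ne_zero
  have h2 := MDifferentiableAt.clm_apply_of_inCoordinates h1 hY (hf.mdifferentiableAt two_ne_zero)
  simpa using! ((mdifferentiableAt_totalSpace _ _).1 h2).2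

/-- `extendVec v` is smooth only near `x`, while smoothness of the connection is applied below to
globally smooth fields; a bump function equal to 1 near `x` bridges the gap. -/
lemma exists_contMDiff_eventuallyEq_extendVec [FiniteDimensional ℝ E] [T2Space M] {x : M}
    (v : TangentSpace 𝓘(ℝ, E) x) : ∃ Y : (y : M) → TangentSpace 𝓘(ℝ, E) y,
      CMDiff ∞ (T% Y) ∧ Y =ᶠ[𝓝 x] extendVec v := by
  obtain ⟨s, hs, hsmooth⟩ := exists_contMDiffOn_extend (k := ∞) 𝓘(ℝ, E) E v
  obtain ⟨ψ, -, hψ⟩ := (SmoothBumpFunction.nhds_basis_tsupport (I := 𝓘(ℝ, E)) x).mem_iff.1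
    (interior_mem_nhds.2 hs)
  refine ⟨(ψ : M → ℝ) • extendVec v, ContMDiffOn.smul_section_of_tsupport
    ψ.contMDiff.contMDiffOn isOpen_interior hψ (hsmooth.mono interior_subset), ?_⟩
  filter_upwards [ψ.eventuallyEq_one] with y hy
  simp only [Pi.smul_apply', hy, Pi.one_apply, one_smul]
  rfl

end

/-! ### Tensoriality and symmetry of the Hessian -/

section

variable {E : Type*} [NormedAddCommGroup E] [NormedSpace ℝ E]
  {M : Type*} [TopologicalSpace M] [ChartedSpace E M] [IsManifold 𝓘(ℝ, E) ∞ M]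

lemma eventually_contMDiffAt {f : M → ℝ} {x : M} {n : ℕ} (hf : CMDiffAt n f x) :
    ∀ᶠ y in 𝓝 x, CMDiffAt n f y :=
  (contMDiffAt_iff_contMDiffAt_nhds (by simp)).1 hf

lemma contMDiffAt_extendVec {x : M} (v : TangentSpace 𝓘(ℝ, E) x) :
    CMDiffAt ∞ (T% (extendVec v)) x :=
  FiberBundle.contMDiffAt_extend (k := ∞) 𝓘(ℝ, E) E v

lemma mdifferentiableAt_extendVec {x : M} (v : TangentSpace 𝓘(ℝ, E) x) :
    MDiffAt (T% (extendVec v)) x :=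
  (contMDiffAt_extendVec v).mdifferentiableAt (by simp)

@[simp] lemma extendVec_self {x : M} (v : TangentSpace 𝓘(ℝ, E) x) : extendVec v x = v :=
  FiberBundle.extend_apply_self E v

/-- Jacobi's identity for `U`, `V`, `f • W`, which amounts to `U (V f) - V (U f) = [U, V] f`. -/
lemma mvfderiv_mlieBracket [CompleteSpace E] {f : M → ℝ} {x : M} (hf : CMDiffAt 2 f x)
    {U V W : (y : M) → TangentSpace 𝓘(ℝ, E) y} (hU : CMDiffAt ∞ (T% U) x)
    (hV : CMDiffAt ∞ (T% V) x) (hW : CMDiffAt ∞ (T% W) x) (hWx : W x ≠ 0) :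
    mvfderiv 𝓘(ℝ, E) (fun y => mvfderiv 𝓘(ℝ, E) f y (V y)) x (U x)
      - mvfderiv 𝓘(ℝ, E) (fun y => mvfderiv 𝓘(ℝ, E) f y (U y)) x (V x)
      = mvfderiv 𝓘(ℝ, E) f x (mlieBracket 𝓘(ℝ, E) U V x) := by
  have hms : minSmoothness ℝ 2 = 2 := by simp
  have hms3 : minSmoothness ℝ 3 = 3 := by simp
  have : IsManifold 𝓘(ℝ, E) (minSmoothness ℝ 3) M := by rw [hms3]; infer_instance
  have hev : ∀ᶠ y in 𝓝 x, MDiffAt f y :=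
    (eventually_contMDiffAt (n := 2) hf).mono fun y hy => hy.mdifferentiableAt (by simp)
  have hfx := hev.self_of_nhds
  have h2 : (2 : WithTop ℕ∞) ≤ ∞ := WithTop.coe_le_coe.2 (le_top : (2 : ℕ∞) ≤ ⊤)
  have : IsManifold 𝓘(ℝ, E) (((2 : ℕ∞) : WithTop ℕ∞) + 1) M :=
    IsManifold.of_le (n := ∞) (WithTop.coe_le_coe.2 (le_top : (2 + 1 : ℕ∞) ≤ ⊤))
  have hU2 : CMDiffAt 2 (T% U) x := hU.of_le h2
  have hV2 : CMDiffAt 2 (T% V) x := hV.of_le h2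
  have hW2 : CMDiffAt 2 (T% W) x := hW.of_le h2
  have hWev : ∀ᶠ y in 𝓝 x, MDiffAt (T% W) y :=
    ((contMDiffAt_iff_contMDiffAt_nhds (by simp)).1 hW2).mono
      fun y hy => hy.mdifferentiableAt (by simp)
  have hfW : CMDiffAt 2 (T% (f • W)) x := hf.smul_section hW2
  have hbr : ∀ Z : (y : M) → TangentSpace 𝓘(ℝ, E) y,
      mlieBracket 𝓘(ℝ, E) Z (f • W) =ᶠ[𝓝 x]
        (fun y => mvfderiv 𝓘(ℝ, E) f y (Z y)) • W + f • mlieBracket 𝓘(ℝ, E) Z W := by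
    intro Z
    filter_upwards [hev, hWev] with y h1 h2
    rw [mlieBracket_smul_right h1 h2]
    rfl
  have hbd : ∀ {Z : (y : M) → TangentSpace 𝓘(ℝ, E) y}, CMDiffAt ∞ (T% Z) x →
      MDiffAt (T% (mlieBracket 𝓘(ℝ, E) Z W)) x := fun hZ =>
    (ContMDiffAt.mlieBracket_vectorField (m := 1) (n := 2) (hZ.of_le h2) hW2
      (by simp [one_add_one_eq_two])).mdifferentiableAt
      (by simp)
  have hdZ : ∀ {Z : (y : M) → TangentSpace 𝓘(ℝ, E) y}, CMDiffAt ∞ (T% Z) x →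
      MDiffAt (fun y => mvfderiv 𝓘(ℝ, E) f y (Z y)) x := fun hZ =>
    mdifferentiableAt_mvfderiv_apply hf (hZ.mdifferentiableAt (by simp))
  have hWd : MDiffAt (T% W) x := hWev.self_of_nhds
  have expand : ∀ {Y Z : (y : M) → TangentSpace 𝓘(ℝ, E) y}, CMDiffAt ∞ (T% Z) x →
      mlieBracket 𝓘(ℝ, E) Y (mlieBracket 𝓘(ℝ, E) Z (f • W)) x =
        mvfderiv 𝓘(ℝ, E) (fun y => mvfderiv 𝓘(ℝ, E) f y (Z y)) x (Y x) • W x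
        + mvfderiv 𝓘(ℝ, E) f x (Z x) • mlieBracket 𝓘(ℝ, E) Y W x
        + (mvfderiv 𝓘(ℝ, E) f x (Y x) • mlieBracket 𝓘(ℝ, E) Z W x
        + f x • mlieBracket 𝓘(ℝ, E) Y (mlieBracket 𝓘(ℝ, E) Z W) x) := by
    intro Y Z hZ
    rw [EventuallyEq.mlieBracket_vectorField_eq (EventuallyEq.refl _ Y) (hbr Z),
      mlieBracket_add_right ((hdZ hZ).smul_section hWd) (hfx.smul_section (hbd hZ)),
      mlieBracket_smul_right (hdZ hZ) hWd, mlieBracket_smul_right hfx (hbd hZ)]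
  -- Expanding Jacobi for `U`, `V`, `f • W` and substituting Jacobi for `U`, `V`, `W` cancels every
  -- term with a bracket involving `W`. Only a multiple of `W x` survives, and `W x ≠ 0` forces its
  -- coefficient to vanish.
  have J := leibniz_identity_mlieBracket_apply (I := 𝓘(ℝ, E)) (hms.symm ▸ hU2) (hms.symm ▸ hV2)
    (hms.symm ▸ hfW)
  have J' := leibniz_identity_mlieBracket_apply (I := 𝓘(ℝ, E)) (hms.symm ▸ hU2) (hms.symm ▸ hV2)
    (hms.symm ▸ hW2)
  rw [expand hV, expand hU, (hbr _).self_of_nhds] at J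
  simp only [Pi.add_apply, Pi.smul_apply'] at J
  rw [J'] at J
  have key : (mvfderiv 𝓘(ℝ, E) (fun y => mvfderiv 𝓘(ℝ, E) f y (V y)) x (U x)
      - mvfderiv 𝓘(ℝ, E) (fun y => mvfderiv 𝓘(ℝ, E) f y (U y)) x (V x)
      - mvfderiv 𝓘(ℝ, E) f x (mlieBracket 𝓘(ℝ, E) U V x)) • W x = 0 := by
    rw [← sub_eq_zero] at J
    rw [← J]
    module
  exact sub_eq_zero.1 ((smul_eq_zero.1 key).resolve_right hWx)

/-- Replacing `Y` by `g • Y` produces the extra term `(u g) Df(Y)` in both summands, by the two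
Leibniz rules, and these cancel. -/
lemma tensorialAt_hessian (cov : AffineConnection E M) {f : M → ℝ} {x : M} (hf : CMDiffAt 2 f x)
    (u : TangentSpace 𝓘(ℝ, E) x) :
    TensorialAt 𝓘(ℝ, E) E (fun Y : (y : M) → TangentSpace 𝓘(ℝ, E) y =>
      mvfderiv 𝓘(ℝ, E) (fun y => mvfderiv 𝓘(ℝ, E) f y (Y y)) x u
        - mvfderiv 𝓘(ℝ, E) f x (cov Y x u)) x where
  smul {g Y} hg hY := by
    have h := mdifferentiableAt_mvfderiv_apply hf hY
    have h1 : mvfderiv 𝓘(ℝ, E) (fun y => mvfderiv 𝓘(ℝ, E) f y ((g • Y) y)) x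
      = mvfderiv 𝓘(ℝ, E) (fun y => g y * mvfderiv 𝓘(ℝ, E) f y (Y y)) x := by
      congr 1; ext y; simp
    rw [h1, mvfderiv_fun_mul hg h, cov.isCovariantDerivativeOn.leibniz hY hg (Set.mem_univ x)]
    simp
    ring
  add {Y Z} hY hZ := by
    have h1 : mvfderiv 𝓘(ℝ, E) (fun y => mvfderiv 𝓘(ℝ, E) f y ((Y + Z) y)) x
      = mvfderiv 𝓘(ℝ, E) (fun y => mvfderiv 𝓘(ℝ, E) f y (Y y) + mvfderiv 𝓘(ℝ, E) f y (Z y)) x := by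
      congr 1; ext y; simp
    rw [h1, mvfderiv_fun_add (mdifferentiableAt_mvfderiv_apply hf hY)
      (mdifferentiableAt_mvfderiv_apply hf hZ),
      cov.isCovariantDerivativeOn.add hY hZ (Set.mem_univ x)]
    simp
    ring

/-- The Hessian may be computed with any vector field extending the second argument. -/
lemma hessian_eq_of_field [FiniteDimensional ℝ E] (cov : AffineConnection E M) {f : M → ℝ} {x : M}
    (hf : CMDiffAt 2 f x) (u : TangentSpace 𝓘(ℝ, E) x)
    {Y : (y : M) → TangentSpace 𝓘(ℝ, E) y} (hY : MDiffAt (T% Y) x) :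
    hessian cov f x u (Y x) = mvfderiv 𝓘(ℝ, E) (fun y => mvfderiv 𝓘(ℝ, E) f y (Y y)) x u
        - mvfderiv 𝓘(ℝ, E) f x (cov Y x u) :=
  (tensorialAt_hessian cov hf u).pointwise (mdifferentiableAt_extendVec _) hY (by simp)

lemma hessian_add_left (cov : AffineConnection E M) (f : M → ℝ) {x : M}
    (u u' v : TangentSpace 𝓘(ℝ, E) x) :
    hessian cov f x (u + u') v = hessian cov f x u v + hessian cov f x u' v := by
  simp only [hessian, covDerivOneForm, differential, map_add]
  ring

lemma hessian_smul_left (cov : AffineConnection E M) (f : M → ℝ) {x : M} (c : ℝ)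
    (u v : TangentSpace 𝓘(ℝ, E) x) :
    hessian cov f x (c • u) v = c * hessian cov f x u v := by
  simp only [hessian, covDerivOneForm, differential, map_smul, smul_eq_mul]
  ring

lemma hessian_comm [FiniteDimensional ℝ E] [CompleteSpace E] (cov : AffineConnection E M)
    (htor : cov.torsion = 0) {f : M → ℝ} {x : M}
    (hf : CMDiffAt 2 f x) (u v : TangentSpace 𝓘(ℝ, E) x) :
    hessian cov f x u v = hessian cov f x v u := by
  -- The bracket formula needs an auxiliary field that does not vanish at `x`. The extension of `u`
  -- serves when `u ≠ 0`; otherwise both sides are zero.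
  by_cases hu : u = 0
  · have h0 := (tensorialAt_hessian cov hf v).zero
    have h1 := hessian_eq_of_field cov hf v (Bundle.mdifferentiable_zeroSection _ _ _ :
      MDiffAt (T% (0 : (y : M) → TangentSpace 𝓘(ℝ, E) y)) x)
    have h2 := hessian_smul_left cov f 0 u v
    subst hu
    simp only [smul_zero, zero_mul] at h2
    rw [h2]
    exact (h1.trans h0).symm
  · have hb := mvfderiv_mlieBracket hf (contMDiffAt_extendVec u) (contMDiffAt_extendVec v)
      (contMDiffAt_extendVec u) (by simpa using hu)
    rw [← cov.torsion_eq_zero_iff.1 htor (mdifferentiableAt_extendVec u)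
      (mdifferentiableAt_extendVec v)] at hb
    simp only [extendVec_self, map_sub] at hb
    simp only [hessian, covDerivOneForm, differential]
    linarith

end

/-! ### Chain rules for the Hessian and its covariant derivative -/

section

variable {E : Type*} [NormedAddCommGroup E] [NormedSpace ℝ E]
  {M : Type*} [TopologicalSpace M] [ChartedSpace E M] [IsManifold 𝓘(ℝ, E) ∞ M]

/-- At `y ≠ x` the Hessian is defined through extensions based at `y`, which vary with `y`.
Tensoriality allows one fixed global field to be used for all `y` near `x`, and the resulting
expression is visibly differentiable. -/
lemma mdifferentiableAt_hessian_extendVec [FiniteDimensional ℝ E] [T2Space M]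
    (cov : AffineConnection E M) [CovariantDerivative.ContMDiffCovariantDerivative cov ∞]
    {f : M → ℝ} {x : M} (hf : CMDiffAt 3 f x) (v w : TangentSpace 𝓘(ℝ, E) x) :
    MDiffAt (fun y => hessian cov f y (extendVec v y) (extendVec w y)) x := by
  obtain ⟨Y, hY, hYv⟩ := exists_contMDiff_eventuallyEq_extendVec v
  obtain ⟨Z, hZ, hZw⟩ := exists_contMDiff_eventuallyEq_extendVec w
  have hf2 : CMDiffAt 2 f x := hf.of_le (by norm_num)
  have hZ2 : CMDiffAt ((2 : ℕ∞) : WithTop ℕ∞) (T% Z) x :=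
    (hZ x).of_le (WithTop.coe_le_coe.2 (le_top : (2 : ℕ∞) ≤ ⊤))
  have hcov : MDiffAt (T% (fun y => cov Z y (Y y))) x := by
    have h := (CovariantDerivative.ContMDiffCovariantDerivative.contMDiff (cov := cov)
      (k := ∞)).contMDiff (σ := Z) (by simpa using hZ.contMDiffOn)
    rw [contMDiffOn_univ] at h
    exact (ContMDiff.clm_bundle_apply h hY x).mdifferentiableAt (by simp)
  have h1 : MDiffAt (fun y => mvfderiv 𝓘(ℝ, E) (fun z => mvfderiv 𝓘(ℝ, E) f z (Z z)) y (Y y)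
      - mvfderiv 𝓘(ℝ, E) f y (cov Z y (Y y))) x :=
    (mdifferentiableAt_mvfderiv_apply
      (contMDiffAt_mvfderiv_apply (m := 2) (n := 3) (by norm_num) hf hZ2)
      ((hY x).mdifferentiableAt (by simp))).sub (mdifferentiableAt_mvfderiv_apply hf2 hcov)
  refine h1.congr_of_eventuallyEq ?_
  filter_upwards [hYv, hZw, eventually_contMDiffAt (n := 2) hf2] with y h2 h3 h4
  rw [← h2, ← h3, hessian_eq_of_field cov h4 _ ((hZ y).mdifferentiableAt (by simp))]

variable {f : M → ℝ} {x : M} {φ φ₁ φ₂ : ℝ → ℝ}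

lemma hessian_scalar_comp (cov : AffineConnection E M) {c : ℝ} (hf : CMDiffAt 2 f x)
    (hφ : ∀ᶠ t in 𝓝 (f x), HasDerivAt φ (φ₁ t) t) (hφ₁ : HasDerivAt φ₁ c (f x))
    (u v : TangentSpace 𝓘(ℝ, E) x) :
    hessian cov (fun y => φ (f y)) x u v
      = φ₁ (f x) * hessian cov f x u v + c * (differential f x u * differential f x v) := by
  have hfx := hf.mdifferentiableAt two_ne_zero
  have hev : (fun y => mvfderiv 𝓘(ℝ, E) (fun z => φ (f z)) y (extendVec v y))
      =ᶠ[𝓝 x] fun y => φ₁ (f y) * mvfderiv 𝓘(ℝ, E) f y (extendVec v y) := by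
    filter_upwards [eventually_contMDiffAt (n := 2) hf, hf.continuousAt.eventually hφ] with y h1 h2
    exact mvfderiv_scalar_comp h2 (h1.mdifferentiableAt (by simp)) _
  have h1 : MDiffAt (fun y => φ₁ (f y)) x :=
    hφ₁.differentiableAt.mdifferentiableAt.comp x hfx
  simp only [hessian, covDerivOneForm, differential]
  rw [mvfderiv_congr hev, mvfderiv_scalar_comp hφ.self_of_nhds hfx, mvfderiv_fun_mul h1
    (mdifferentiableAt_mvfderiv_apply hf (mdifferentiableAt_extendVec v))]
  simp only [add_apply, smul_apply, smul_eq_mul,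
    mvfderiv_scalar_comp hφ₁ hfx, extendVec_self]
  ring

lemma covDerivBilin_hessian_scalar_comp [FiniteDimensional ℝ E] [T2Space M]
    (cov : AffineConnection E M) [CovariantDerivative.ContMDiffCovariantDerivative cov ∞] {c : ℝ}
    (hf : CMDiffAt 3 f x) (hφ : ∀ᶠ t in 𝓝 (f x), HasDerivAt φ (φ₁ t) t)
    (hφ₁ : ∀ᶠ t in 𝓝 (f x), HasDerivAt φ₁ (φ₂ t) t) (hφ₂ : HasDerivAt φ₂ c (f x))
    (u v w : TangentSpace 𝓘(ℝ, E) x) :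
    covDerivBilin cov (hessian cov (fun y => φ (f y))) x u v w
      = φ₁ (f x) * covDerivBilin cov (hessian cov f) x u v w
        + φ₂ (f x) * (differential f x u * hessian cov f x v w
          + hessian cov f x u v * differential f x w + differential f x v * hessian cov f x u w)
        + c * (differential f x u * differential f x v * differential f x w) := by
  have hf2 : CMDiffAt 2 f x := hf.of_le (by norm_num)
  have hfx := hf2.mdifferentiableAt two_ne_zero
  have hev : (fun y => hessian cov (fun z => φ (f z)) y (extendVec v y) (extendVec w y))
      =ᶠ[𝓝 x] fun y => φ₁ (f y) * hessian cov f y (extendVec v y) (extendVec w y)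
        + φ₂ (f y) * (mvfderiv 𝓘(ℝ, E) f y (extendVec v y)
          * mvfderiv 𝓘(ℝ, E) f y (extendVec w y)) := by
    filter_upwards [eventually_contMDiffAt (n := 2) hf2,
      hf.continuousAt.eventually hφ.eventually_nhds,
      hf.continuousAt.eventually hφ₁] with y h1 h2 h3
    exact hessian_scalar_comp cov h1 h2 h3 _ _
  have hv := mdifferentiableAt_mvfderiv_apply hf2 (mdifferentiableAt_extendVec v)
  have hw := mdifferentiableAt_mvfderiv_apply hf2 (mdifferentiableAt_extendVec w)
  have hH := mdifferentiableAt_hessian_extendVec cov hf v w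
  have h1 : MDiffAt (fun y => φ₁ (f y)) x :=
    hφ₁.self_of_nhds.differentiableAt.mdifferentiableAt.comp x hfx
  have h2 : MDiffAt (fun y => φ₂ (f y)) x :=
    hφ₂.differentiableAt.mdifferentiableAt.comp x hfx
  have h3 : MDiffAt (fun y => mvfderiv 𝓘(ℝ, E) f y (extendVec v y)
      * mvfderiv 𝓘(ℝ, E) f y (extendVec w y)) x := hv.mul hw
  have h4 : MDiffAt (fun y => φ₁ (f y) * hessian cov f y (extendVec v y) (extendVec w y)) x :=
    h1.mul hH
  have h5 : MDiffAt (fun y => φ₂ (f y) * (mvfderiv 𝓘(ℝ, E) f y (extendVec v y)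
      * mvfderiv 𝓘(ℝ, E) f y (extendVec w y))) x := h2.mul h3
  rw [covDerivBilin, mvfderiv_congr hev, mvfderiv_fun_add h4 h5,
    mvfderiv_fun_mul h1 hH, mvfderiv_fun_mul h2 h3, mvfderiv_fun_mul hv hw,
    hessian_scalar_comp cov hf2 hφ hφ₁.self_of_nhds,
    hessian_scalar_comp cov hf2 hφ hφ₁.self_of_nhds]
  simp only [add_apply, smul_apply, smul_eq_mul,
    mvfderiv_scalar_comp hφ₁.self_of_nhds hfx, mvfderiv_scalar_comp hφ₂ hfx, extendVec_self,
    covDerivBilin]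
  -- Second derivatives of `f` are traded for the Hessian plus a connection term; the connection
  -- terms then cancel against the corrections in `covDerivBilin`.
  have e1 : ∀ z : TangentSpace 𝓘(ℝ, E) x,
      mvfderiv 𝓘(ℝ, E) (fun y => mvfderiv 𝓘(ℝ, E) f y (extendVec z y)) x u
      = hessian cov f x u z + mvfderiv 𝓘(ℝ, E) f x (cov (extendVec z) x u) := fun z => by
    simp only [hessian, covDerivOneForm, differential]
    ring
  simp only [e1, differential]
  ring

/-- The Cauchy-Schwarz inequality for a positive semidefinite Hessian. -/
lemma hessian_sq_le [FiniteDimensional ℝ E] [CompleteSpace E] (cov : AffineConnection E M)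
    (htor : cov.torsion = 0) (hf : CMDiffAt 2 f x)
    (hpos : ∀ u : TangentSpace 𝓘(ℝ, E) x, 0 ≤ hessian cov f x u u)
    (u v : TangentSpace 𝓘(ℝ, E) x) :
    hessian cov f x u v ^ 2 ≤ hessian cov f x u u * hessian cov f x v v := by
  have h := discrim_le_zero (a := hessian cov f x v v) (b := 2 * hessian cov f x u v)
    (c := hessian cov f x u u) fun t => by
      have h1 := hpos (u + t • v)
      rw [hessian_add_left, hessian_smul_left, hessian_comm cov htor hf u (u + t • v),
        hessian_comm cov htor hf v (u + t • v), hessian_add_left, hessian_add_left,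
        hessian_smul_left, hessian_smul_left, hessian_comm cov htor hf v u] at h1
      linarith
  rw [discrim] at h
  linarith

end

/-! ### Sublevel sets of convex functions -/

section Sublevel

variable {E : Type*} [NormedAddCommGroup E] [NormedSpace ℝ E]
  {M : Type*} [TopologicalSpace M] [ChartedSpace E M] [IsManifold 𝓘(ℝ, E) ∞ M]
  {cov : AffineConnection E M} {f : M → ℝ} {β : ℝ}

lemma IsGeodesic.continuous {γ : ℝ → M} (hγ : IsGeodesic cov γ) : Continuous γ :=
  hγ.1.continuous

/-- If `f x = β` at an interior point, a geodesic from `z` to `x` can be prolonged slightly beyond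
`x` while staying in the sublevel set. Then `x` lies strictly between a point with value below `β`
and one with value at most `β`, so convexity gives `f x < β`, a contradiction. -/
lemma interior_sublevel (hexp : ExpSurjective cov) (hf : Continuous f)
    (hconv : GeodConvexOn cov Set.univ f) {z : M} (hz : f z < β) :
    interior (sublevel f β) = {x | f x < β} := by
  refine Set.Subset.antisymm (fun x hx => ?_)
    (interior_maximal (fun x (hx : f x < β) => hx.le) (isOpen_lt hf continuous_const))
  have hxβ' : f x ≤ β := interior_subset (s := sublevel f β) hx
  refine lt_of_le_of_ne hxβ' fun hxβ => ?_
  obtain ⟨γ, hγ, h0, h1⟩ := hexp z x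
  have hev : ∀ᶠ t in 𝓝 (1 : ℝ), γ t ∈ interior (sublevel f β) :=
    hγ.continuous.continuousAt.eventually (h1.symm ▸ isOpen_interior.mem_nhds hx)
  obtain ⟨t, ht, ht1⟩ := ((hev.filter_mono nhdsWithin_le_nhds).and
    (self_mem_nhdsWithin (s := Set.Ioi (1 : ℝ)))).exists
  have htβ : f (γ t) ≤ β := interior_subset (s := sublevel f β) ht
  have h2 := (hconv γ hγ 0 t (by linarith) fun _ _ => Set.mem_univ _).2
    (Set.left_mem_Icc.2 (by linarith)) (Set.right_mem_Icc.2 (by linarith))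
    (sub_nonneg.2 (inv_le_one_of_one_le₀ ht1.le)) (inv_nonneg.2 (by linarith : (0 : ℝ) ≤ t))
    (by ring)
  simp only [smul_eq_mul, mul_zero, zero_add, inv_mul_cancel₀ (by linarith : t ≠ 0), h0, h1,
    hxβ] at h2
  have h3 : 0 < 1 - t⁻¹ := sub_pos.2 (inv_lt_one_of_one_lt₀ ht1)
  have h4 : (0 : ℝ) ≤ t⁻¹ := inv_nonneg.2 (by linarith)
  nlinarith [mul_pos h3 (sub_pos.2 hz), mul_nonneg h4 (sub_nonneg.2 htβ)]

/-- On a geodesic from `z` to a point `x` of the sublevel set, convexity keeps `f` strictly below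
`β` before the end point, so `x` is a limit of interior points. -/
lemma closure_interior_sublevel (hexp : ExpSurjective cov) (hf : Continuous f)
    (hconv : GeodConvexOn cov Set.univ f) {z : M} (hz : f z < β) :
    closure (interior (sublevel f β)) = sublevel f β := by
  refine Set.Subset.antisymm
    (closure_minimal interior_subset (isClosed_le hf continuous_const)) fun x hx => ?_
  rw [interior_sublevel hexp hf hconv hz]
  obtain ⟨γ, hγ, h0, h1⟩ := hexp z x
  have ht : Tendsto γ (𝓝[<] 1) (𝓝 x) :=
    h1 ▸ hγ.continuous.continuousAt.tendsto.mono_left nhdsWithin_le_nhds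
  refine mem_closure_of_tendsto ht ?_
  filter_upwards [Ioo_mem_nhdsLT (zero_lt_one : (0 : ℝ) < 1)] with t ht
  have h2 := (hconv γ hγ 0 1 zero_le_one fun _ _ => Set.mem_univ _).2
    (Set.left_mem_Icc.2 zero_le_one) (Set.right_mem_Icc.2 zero_le_one)
    (sub_nonneg.2 ht.2.le) ht.1.le (by ring)
  simp only [smul_eq_mul, mul_zero, zero_add, mul_one, h0, h1] at h2
  have hx' : f x ≤ β := hx
  have h3 := mul_pos (sub_pos.2 ht.2) (sub_pos.2 hz)
  have h4 := mul_nonneg ht.1.le (sub_nonneg.2 hx')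
  change f (γ t) < β
  nlinarith

lemma geodConvex_strictSublevel (hconv : GeodConvexOn cov Set.univ f) :
    GeodConvex cov {x | f x < β} := fun γ hγ a b hab ha hb _ ht =>
  ((hconv γ hγ a b hab fun _ _ => Set.mem_univ _).le_max_of_mem_Icc
    (Set.left_mem_Icc.2 hab) (Set.right_mem_Icc.2 hab) ht).trans_lt (max_lt ha hb)

end Sublevel

/-! ### Real inequalities -/

/-- Cauchy-Schwarz in `(p, q)` reduces this to bounding `A² + B²`. From `2rt ≤ r² + t²` come `A ≤
(2s + 1)R` and `B ≤ 2R`, and `(2s + 1)² + 4 ≤ 4((s + 1)² + 9/4)` with room to spare. -/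
lemma concordance_inequality {s p r q t : ℝ} (hs : 0 ≤ s) (hr : 0 ≤ r) (ht : 0 ≤ t) :
    p * (2 * s * r ^ 2 + 2 * r * t) + q * (r ^ 2 + 2 * t ^ 2)
      ≤ 2 * √((s + 1) ^ 2 + 9 / 4) * √(p ^ 2 + q ^ 2) * (r ^ 2 + t ^ 2) := by
  set R := r ^ 2 + t ^ 2 with hR
  have hR0 : 0 ≤ R := by positivity
  set A := 2 * s * r ^ 2 + 2 * r * t with hA
  set B := r ^ 2 + 2 * t ^ 2 with hB
  have hA0 : 0 ≤ A := by positivity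
  have hB0 : 0 ≤ B := by positivity
  have hAR : A ≤ (2 * s + 1) * R := by
    nlinarith [sq_nonneg (r - t), mul_nonneg hs (sq_nonneg t)]
  have hBR : B ≤ 2 * R := by nlinarith [sq_nonneg r]
  have hAB : A ^ 2 + B ^ 2 ≤ 4 * ((s + 1) ^ 2 + 9 / 4) * R ^ 2 := by
    have h1 := pow_le_pow_left₀ hA0 hAR 2
    have h2 := pow_le_pow_left₀ hB0 hBR 2
    nlinarith [mul_nonneg hs (sq_nonneg R), sq_nonneg R]
  refine le_of_sq_le_sq ?_ (by positivity)
  rw [mul_pow, mul_pow, mul_pow, Real.sq_sqrt (by positivity), Real.sq_sqrt (by positivity)]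
  calc (p * A + q * B) ^ 2 ≤ (p ^ 2 + q ^ 2) * (A ^ 2 + B ^ 2) := by
        nlinarith [sq_nonneg (p * B - q * A)]
    _ ≤ (p ^ 2 + q ^ 2) * (4 * ((s + 1) ^ 2 + 9 / 4) * R ^ 2) := by gcongr
    _ = _ := by ring

/-- Self-concordance of `F` at one point, with `a = Hf(u,u)`, `b = Hf(v,v)`, `h = Hf(v,u)`, `T =
(∇_v Hf)(u,u)`, `du = Df(u)`, `dv = Df(v)`, `w = β - f x` and `m = β - f*`. -/
lemma logBarrier_inequality {σ m w a b h T du dv : ℝ} (hσ : 0 ≤ σ) (hw : 0 < w) (hwm : w ≤ m)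
    (ha : 0 ≤ a) (hb : 0 ≤ b) (hh : h ^ 2 ≤ b * a) (hT : |T| ≤ 2 * σ * √b * a) :
    |w⁻¹ * T + (w ^ 2)⁻¹ * (dv * a + h * du + du * h) + 2 * (w ^ 3)⁻¹ * (dv * du * du)|
      ≤ 2 * √((σ * √m + 1) ^ 2 + 9 / 4) * √(w⁻¹ * b + (w ^ 2)⁻¹ * (dv * dv))
        * (w⁻¹ * a + (w ^ 2)⁻¹ * (du * du)) := by
  set k := w⁻¹ with hk
  have hk0 : 0 < k := inv_pos.2 hw
  have hkw : k * w = 1 := inv_mul_cancel₀ hw.ne'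
  rw [← inv_pow, ← inv_pow, ← hk]
  have e1 : k * b + k ^ 2 * (dv * dv) = (√k * √b) ^ 2 + |k * dv| ^ 2 := by
    rw [mul_pow, Real.sq_sqrt hk0.le, Real.sq_sqrt hb, sq_abs]; ring
  have e2 : k * a + k ^ 2 * (du * du) = (√k * √a) ^ 2 + |k * du| ^ 2 := by
    rw [mul_pow, Real.sq_sqrt hk0.le, Real.sq_sqrt ha, sq_abs]; ring
  rw [e1, e2]
  refine le_trans ?_ (concordance_inequality (mul_nonneg hσ (Real.sqrt_nonneg m))
    (by positivity) (abs_nonneg _))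
  have hra : (√k * √a) ^ 2 = k * a := by
    rw [mul_pow, Real.sq_sqrt hk0.le, Real.sq_sqrt ha]
  -- The bound on `k * T` is short of a factor `√k`; inserting `√m * √k ≥ 1` supplies it and
  -- replaces `σ` by `σ√m`.
  have hmk : 1 ≤ √m * √k := by
    rw [← Real.sqrt_mul (hw.le.trans hwm), Real.one_le_sqrt, ← hkw, mul_comm]
    gcongr
  have t1 : |k * T| ≤ √k * √b * (2 * (σ * √m) * (k * a)) := by
    rw [abs_mul, abs_of_pos hk0]
    calc k * |T| ≤ k * (2 * σ * √b * a) * 1 := by rw [mul_one]; gcongr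
      _ ≤ k * (2 * σ * √b * a) * (√m * √k) := by gcongr
      _ = _ := by ring
  have hh' : |h| ≤ √b * √a := by
    rw [← Real.sqrt_mul hb]; exact Real.abs_le_sqrt hh
  have t2 : |k ^ 2 * (h * du)| ≤ √k * √b * (√k * √a * |k * du|) := by
    have : |k ^ 2 * (h * du)| = k * |h| * |k * du| := by
      simp only [abs_mul, abs_pow, abs_of_pos hk0]; ring
    rw [this]
    calc k * |h| * |k * du| ≤ k * (√b * √a) * |k * du| := by gcongr
      _ = √k ^ 2 * (√b * √a) * |k * du| := by rw [Real.sq_sqrt hk0.le]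
      _ = _ := by ring
  have t3 : |k ^ 2 * (dv * a)| = |k * dv| * (k * a) := by
    simp only [abs_mul, abs_pow, abs_of_pos hk0, abs_of_nonneg ha]; ring
  have t4 : |k ^ 3 * (dv * du * du)| = |k * dv| * |k * du| ^ 2 := by
    simp only [abs_mul, abs_pow, abs_of_pos hk0]; ring
  rw [hra]
  have e : k * T + k ^ 2 * (dv * a + h * du + du * h) + 2 * k ^ 3 * (dv * du * du)
      = k * T + k ^ 2 * (dv * a) + 2 * (k ^ 2 * (h * du)) + 2 * (k ^ 3 * (dv * du * du)) := by ring
  rw [e]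
  refine (abs_add_le _ _).trans ((add_le_add_left (abs_add_three _ _ _) _).trans ?_)
  rw [abs_mul 2 (k ^ 2 * (h * du)), abs_mul 2 (k ^ 3 * (dv * du * du)), abs_two, t3, t4]
  linarith

lemma hasDerivAt_mul_left (a t : ℝ) : HasDerivAt (fun t => a * t) a t := by
  simpa using (hasDerivAt_id t).const_mul a

lemma hasDerivAt_neg_log_sub {β t : ℝ} (h : t < β) :
    HasDerivAt (fun t => -Real.log (β - t)) (β - t)⁻¹ t := by
  have h1 : HasDerivAt (fun t => -Real.log (β - t)) (-(-1 / (β - t))) t :=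
    (((hasDerivAt_id t).const_sub β).log (sub_ne_zero.2 h.ne')).neg
  exact h1.congr_deriv (by rw [neg_div, neg_neg, one_div])

lemma hasDerivAt_inv_sub_pow {β t : ℝ} (h : t < β) (n : ℕ) :
    HasDerivAt (fun t => ((β - t) ^ n)⁻¹) (n * ((β - t) ^ (n + 1))⁻¹) t := by
  have h0 : β - t ≠ 0 := sub_ne_zero.2 h.ne'
  have h1 : HasDerivAt (fun t => ((β - t) ^ n)⁻¹)
      (-(n * (β - t) ^ (n - 1) * -1) / ((β - t) ^ n) ^ 2) t :=
    (((hasDerivAt_id t).const_sub β).pow n).inv (pow_ne_zero n h0)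
  refine h1.congr_deriv ?_
  rcases n with _ | n
  · simp
  · rw [Nat.add_sub_cancel]
    field_simp
    ring

/-! ### Scaling and the logarithmic barrier -/

section Barrier

variable {E : Type*} [NormedAddCommGroup E] [NormedSpace ℝ E]
  {M : Type*} [TopologicalSpace M] [ChartedSpace E M]

lemma _root_.ContMDiffAt.three_of_infty {f : M → ℝ} {x : M}
    (hf : ContMDiffAt 𝓘(ℝ, E) 𝓘(ℝ, ℝ) ∞ f x) : ContMDiffAt 𝓘(ℝ, E) 𝓘(ℝ, ℝ) 3 f x :=
  hf.of_le (WithTop.coe_le_coe.2 (le_top : (3 : ℕ∞) ≤ ⊤))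

lemma differential_const_mul {F : M → ℝ} {x : M} (hF : CMDiffAt 3 F x) (a : ℝ)
    (u : TangentSpace 𝓘(ℝ, E) x) :
    differential (fun x => a * F x) x u = a * differential F x u :=
  mvfderiv_scalar_comp (hasDerivAt_mul_left a _) (hF.mdifferentiableAt (by simp)) u

variable {f : M → ℝ} {β : ℝ} {x : M}

lemma differential_logBarrier (hf : CMDiffAt 3 f x) (hx : f x < β) (u : TangentSpace 𝓘(ℝ, E) x) :
    differential (logBarrier f β) x u = (β - f x)⁻¹ * differential f x u :=
  mvfderiv_scalar_comp (hasDerivAt_neg_log_sub hx) (hf.mdifferentiableAt (by simp)) u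

/-- Exponentiating turns the epigraph into `exp (-y) ≤ β - f x`, a closed condition that already
forces `f x < β`. -/
lemma isClosed_epigraph_logBarrier (hf : Continuous f) :
    IsClosed {p : M × ℝ | p.1 ∈ {x | f x < β} ∧ logBarrier f β p.1 ≤ p.2} := by
  have h : {p : M × ℝ | p.1 ∈ {x | f x < β} ∧ logBarrier f β p.1 ≤ p.2}
      = {p : M × ℝ | Real.exp (-p.2) ≤ β - f p.1} := by
    ext p
    simp only [Set.mem_ofPred_eq, logBarrier, neg_le]
    constructor
    · rintro ⟨h1, h2⟩
      exact (Real.le_log_iff_exp_le (sub_pos.2 h1)).1 h2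
    · intro h
      have h1 : 0 < β - f p.1 := (Real.exp_pos _).trans_le h
      exact ⟨sub_pos.1 h1, (Real.le_log_iff_exp_le h1).2 h⟩
  rw [h]
  exact isClosed_le (by fun_prop) (by fun_prop)

variable [IsManifold 𝓘(ℝ, E) ∞ M] {cov : AffineConnection E M}

lemma hessian_const_mul {F : M → ℝ} {x : M} (hF : CMDiffAt 3 F x) (a : ℝ)
    (u v : TangentSpace 𝓘(ℝ, E) x) :
    hessian cov (fun x => a * F x) x u v = a * hessian cov F x u v := by
  simpa using hessian_scalar_comp (φ₁ := fun _ => a) cov (hF.of_le (by norm_num))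
    (Eventually.of_forall (hasDerivAt_mul_left a)) (hasDerivAt_const _ _) u v

lemma hessian_logBarrier (hf : CMDiffAt 3 f x) (hx : f x < β) (u v : TangentSpace 𝓘(ℝ, E) x) :
    hessian cov (logBarrier f β) x u v = (β - f x)⁻¹ * hessian cov f x u v
      + ((β - f x) ^ 2)⁻¹ * (differential f x u * differential f x v) :=
  hessian_scalar_comp (φ₁ := fun t => (β - t)⁻¹) cov (hf.of_le (by norm_num))
    ((eventually_lt_nhds hx).mono fun _ h => hasDerivAt_neg_log_sub h)
    (by simpa [one_add_one_eq_two] using hasDerivAt_inv_sub_pow hx 1) u v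

/-- Along a geodesic `β - f` is concave and positive, and `log` is concave and increasing. -/
lemma geodConvexOn_logBarrier (hconv : GeodConvexOn cov Set.univ f) :
    GeodConvexOn cov {x | f x < β} (logBarrier f β) := by
  intro γ hγ a b hab hC
  have hg := hconv γ hγ a b hab fun _ _ => Set.mem_univ _
  refine ⟨hg.1, fun s hs t ht p q hp hq hpq => ?_⟩
  have hst := hg.1 hs ht hp hq hpq
  have hs' : 0 < β - f (γ s) := sub_pos.2 (hC s hs)
  have ht' : 0 < β - f (γ t) := sub_pos.2 (hC t ht)
  have h1 := strictConcaveOn_log_Ioi.concaveOn.2 hs' ht' hp hq hpq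
  have h2 := hg.2 hs ht hp hq hpq
  have hpos : 0 < p • (β - f (γ s)) + q • (β - f (γ t)) :=
    (convex_Ioi (0 : ℝ)) hs' ht' hp hq hpq
  have h3 : p • (β - f (γ s)) + q • (β - f (γ t)) ≤ β - f (γ (p • s + q • t)) := by
    simp only [smul_eq_mul] at h2 ⊢
    linear_combination h2 + β * hpq
  have h4 := Real.log_le_log hpos h3
  simp only [logBarrier, smul_eq_mul] at *
  linarith

lemma IsSelfConcordant.hessian_self_nonneg {σ : ℝ} {C : Set M} (h : IsSelfConcordant cov σ C f)
    (hx : x ∈ C) (u : TangentSpace 𝓘(ℝ, E) x) : 0 ≤ hessian cov f x u u := by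
  by_cases hu : u = 0
  · have h0 := hessian_smul_left cov f 0 u u
    rw [zero_mul, zero_smul, ← hu] at h0
    exact h0.ge
  · exact (h.nondegenerate x hx u hu).le

/-- With `s = DF(u)`, positivity of `Hf` gives `HF(u,u) ≥ s²`, and `2s - s² ≤ 1`. -/
lemma IsSelfConcordant.logBarrier_gradient_le {σ : ℝ} (h : IsSelfConcordant cov σ Set.univ f)
    (hx : f x < β) (u : TangentSpace 𝓘(ℝ, E) x) :
    2 * differential (SelfConcordance.logBarrier f β) x u
      - hessian cov (SelfConcordance.logBarrier f β) x u u ≤ 1 := by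
  have hf := ((contMDiffOn_univ.1 h.smooth) x).three_of_infty
  have hw : 0 < (β - f x)⁻¹ := inv_pos.2 (sub_pos.2 hx)
  rw [differential_logBarrier hf hx, hessian_logBarrier hf hx, ← inv_pow]
  nlinarith [mul_nonneg hw.le (h.hessian_self_nonneg (Set.mem_univ x) u),
    sq_nonneg ((β - f x)⁻¹ * differential f x u - 1)]

variable [FiniteDimensional ℝ E] [T2Space M]
  [CovariantDerivative.ContMDiffCovariantDerivative cov ∞]

lemma covDerivBilin_hessian_const_mul {F : M → ℝ} {x : M} (hF : CMDiffAt 3 F x) (a : ℝ)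
    (u v w : TangentSpace 𝓘(ℝ, E) x) :
    covDerivBilin cov (hessian cov (fun x => a * F x)) x u v w
      = a * covDerivBilin cov (hessian cov F) x u v w := by
  simpa using covDerivBilin_hessian_scalar_comp (φ₁ := fun _ => a) (φ₂ := fun _ => 0) cov hF
    (Eventually.of_forall (hasDerivAt_mul_left a))
    (Eventually.of_forall fun _ => hasDerivAt_const _ _) (hasDerivAt_const _ _) u v w

lemma covDerivBilin_hessian_logBarrier (hf : CMDiffAt 3 f x) (hx : f x < β)
    (u v w : TangentSpace 𝓘(ℝ, E) x) :
    covDerivBilin cov (hessian cov (logBarrier f β)) x u v w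
      = (β - f x)⁻¹ * covDerivBilin cov (hessian cov f) x u v w
        + ((β - f x) ^ 2)⁻¹ * (differential f x u * hessian cov f x v w
          + hessian cov f x u v * differential f x w + differential f x v * hessian cov f x u w)
        + 2 * ((β - f x) ^ 3)⁻¹ * (differential f x u * differential f x v * differential f x w) :=
  covDerivBilin_hessian_scalar_comp (φ₁ := fun t => (β - t)⁻¹) (φ₂ := fun t => ((β - t) ^ 2)⁻¹)
    cov hf ((eventually_lt_nhds hx).mono fun _ h => hasDerivAt_neg_log_sub h)
    ((eventually_lt_nhds hx).mono fun _ h => by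
      simpa [one_add_one_eq_two] using hasDerivAt_inv_sub_pow h 1)
    (by simpa using hasDerivAt_inv_sub_pow hx 2) u v w

/-- Scaling a `σ`-self-concordant function by `a` gives a `σ / √a`-self-concordant function. -/
lemma IsSelfConcordant.const_mul {σ : ℝ} {C : Set M} {F : M → ℝ}
    (h : IsSelfConcordant cov σ C F) {a : ℝ} (ha : 0 < a) :
    IsSelfConcordant cov (σ / √a) C (fun x => a * F x) := by
  have hF : ∀ x ∈ C, CMDiffAt 3 F x := fun x hx =>
    (h.smooth.contMDiffAt (h.isOpen_domain.mem_nhds hx)).three_of_infty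
  refine ⟨div_nonneg h.sigma_nonneg (Real.sqrt_nonneg a), h.isOpen_domain, h.convex_domain,
    contMDiffOn_const.mul h.smooth, fun γ hγ s t hst hC => (h.convex γ hγ s t hst hC).smul ha.le,
    ?_, fun x hx u hu => ?_, fun x hx u v => ?_⟩
  · have hc : Continuous fun p : M × ℝ => (p.1, a⁻¹ * p.2) := by fun_prop
    convert h.closed.preimage hc using 1
    ext p
    simp [le_inv_mul_iff₀ ha]
  · rw [hessian_const_mul (hF x hx)]
    exact mul_pos ha (h.nondegenerate x hx u hu)
  · rw [hessian_const_mul (hF x hx), hessian_const_mul (hF x hx),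
      covDerivBilin_hessian_const_mul (hF x hx), abs_mul, abs_of_pos ha, Real.sqrt_mul ha.le]
    have hsa : √a ≠ 0 := (Real.sqrt_pos.2 ha).ne'
    calc a * |covDerivBilin cov (hessian cov F) x v u u|
        ≤ a * (2 * σ * √(hessian cov F x v v) * hessian cov F x u u) := by
          gcongr
          exact h.concordant x hx u v
      _ = _ := by field_simp

/-- The logarithmic barrier of a sublevel set is self-concordant. -/
lemma IsSelfConcordant.logBarrier {σ : ℝ} (h : IsSelfConcordant cov σ Set.univ f)
    (htor : cov.torsion = 0) (hbdd : BddBelow (Set.range f)) :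
    IsSelfConcordant cov (√((σ * √(β - ⨅ x, f x) + 1) ^ 2 + 9 / 4)) {x | f x < β}
      (logBarrier f β) := by
  have hsm : ContMDiff 𝓘(ℝ, E) 𝓘(ℝ, ℝ) ∞ f := contMDiffOn_univ.1 h.smooth
  have hf : ∀ x, CMDiffAt 3 f x := fun x => (hsm x).three_of_infty
  refine ⟨Real.sqrt_nonneg _, isOpen_lt hsm.continuous continuous_const,
    geodConvex_strictSublevel h.convex, fun x hx => ?_, geodConvexOn_logBarrier h.convex,
    isClosed_epigraph_logBarrier hsm.continuous, fun x hx u hu => ?_, fun x hx u v => ?_⟩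
  · have hx0 : β - f x ≠ 0 := (sub_pos.2 hx).ne'
    have h1 : ContDiffAt ℝ ∞ (fun t => -Real.log (β - t)) (f x) :=
      ((contDiffAt_const.sub contDiffAt_id).log hx0).neg
    exact (h1.contMDiffAt.comp x (hsm x)).contMDiffWithinAt
  · have hw : 0 < β - f x := sub_pos.2 hx
    rw [hessian_logBarrier (hf x) hx]
    have h1 := h.nondegenerate x (Set.mem_univ x) u hu
    have h2 := mul_self_nonneg (differential f x u)
    positivity
  · have hw : 0 < β - f x := sub_pos.2 hx
    rw [hessian_logBarrier (hf x) hx, hessian_logBarrier (hf x) hx,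
      covDerivBilin_hessian_logBarrier (hf x) hx]
    exact logBarrier_inequality h.sigma_nonneg hw (sub_le_sub_left (ciInf_le hbdd x) β)
      (h.hessian_self_nonneg (Set.mem_univ x) u)
      (h.hessian_self_nonneg (Set.mem_univ x) v)
      (hessian_sq_le cov htor ((hf x).of_le (by norm_num)) (h.hessian_self_nonneg (Set.mem_univ x)) v u)
      (h.concordant x (Set.mem_univ x) u v)

end Barrier

end SelfConcordance

end

theorem mainTheorem7 :
    ∃ K : ℝ, 0 < K ∧
      ∀ (E : Type*) [NormedAddCommGroup E] [NormedSpace ℝ E] [FiniteDimensional ℝ E]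
        (M : Type*) [TopologicalSpace M] [T2Space M] [SecondCountableTopology M] [Nonempty M]
        [ChartedSpace E M] [IsManifold 𝓘(ℝ, E) ∞ M]
        (cov : SelfConcordance.AffineConnection E M)
        [CovariantDerivative.ContMDiffCovariantDerivative cov ∞],
        cov.torsion = 0 →
        SelfConcordance.IsGeodesicallyComplete cov →
        SelfConcordance.ExpSurjective cov →
        ∀ (σ : ℝ) (f : M → ℝ),
          SelfConcordance.IsSelfConcordant cov σ Set.univ f →
          BddBelow (Set.range f) →
          ∀ β : ℝ, (⨅ x, f x) < β →
            SelfConcordance.IsSelfConcordant cov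
                (√((σ * √(β - ⨅ x, f x) + 1) ^ 2 + 9 / 4))
                (interior (SelfConcordance.sublevel f β)) (SelfConcordance.logBarrier f β) ∧
              ∃ ν : ℝ, ν ≤ K * max 1 (σ ^ 2 * (β - ⨅ x, f x)) ∧
                SelfConcordance.AdmitsBarrier cov ν (SelfConcordance.sublevel f β) := by
  -- With `s² = σ²(β - f*)`, one has `(s + 1)² + 9/4 ≤ 2s² + 17/4 ≤ (25/4) max 1 s²`, so 7 suffices.
  refine ⟨7, by norm_num, ?_⟩
  intro E _ _ _ M _ _ _ _ _ _ cov _ htor _ hexp σ f hf hbdd β hβ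
  obtain ⟨z, hz⟩ := exists_lt_of_ciInf_lt hβ
  have hsm : ContMDiff 𝓘(ℝ, E) 𝓘(ℝ, ℝ) ∞ f := contMDiffOn_univ.1 hf.smooth
  have hint := SelfConcordance.interior_sublevel hexp hsm.continuous hf.convex hz
  have hlog := hf.logBarrier (β := β) htor hbdd
  -- `a = σ̃²` is both the scaling factor that makes the logarithmic barrier 1-self-concordant and
  -- the barrier parameter `ν`.
  set a := (σ * √(β - ⨅ x, f x) + 1) ^ 2 + 9 / 4 with ha
  have ha0 : 0 < a := by positivity
  have hscaled := hlog.const_mul ha0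
  rw [div_self (Real.sqrt_pos.2 ha0).ne'] at hscaled
  rw [hint]
  refine ⟨hlog, a, ?_, SelfConcordance.closure_interior_sublevel hexp hsm.continuous hf.convex hz,
    _, ha0, hint.symm ▸ hscaled, fun x hx u => ?_⟩
  · have h1 : (σ * √(β - ⨅ x, f x)) ^ 2 = σ ^ 2 * (β - ⨅ x, f x) := by
      rw [mul_pow, Real.sq_sqrt (sub_pos.2 hβ).le]
    have h2 := le_max_left 1 (σ ^ 2 * (β - ⨅ x, f x))
    have h3 := le_max_right 1 (σ ^ 2 * (β - ⨅ x, f x))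
    nlinarith [sq_nonneg (σ * √(β - ⨅ x, f x) - 1)]
  · rw [hint] at hx
    have hF := (hlog.smooth.contMDiffAt (hlog.isOpen_domain.mem_nhds hx)).three_of_infty
    rw [SelfConcordance.differential_const_mul hF, SelfConcordance.hessian_const_mul hF]
    nlinarith [hf.logBarrier_gradient_le hx u]
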